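/- All graphs are finite, simple and undirected. The radius of a connected graph $G$ is $\min_{u}\max_{v} d_G(u,v)$, its centre is the set of vertices $u$ attaining the minimum, and the rainbow connection number $rc(G)$ is the least number of colours in an edge colouring of $G$ for which any two vertices are joined by a path no two of whose edges have the same colour. A graph is $\kappa$-connected if it has more than $\kappa$ vertices and remains connected whenever fewer than $\kappa$ vertices are removed; it is bridgeless if it is connected and has no bridge. Let $\kappa, r \ge 1$ be integers. Put $s(0)=0$, $s(i) = 2\sum_{j=r-i+1}^{r} j$ for $1\le i\le r$, and $t = s(r) = r(r+1)$. Let $X_{r,\kappa}$ be the graph on the disjoint union $V_0 \cup V_1 \cup\dots\cup V_t$, where $V_i = \{x_{i,0},\dots,x_{i,\kappa-1}\}$ for $0 \le i \le t-1$ and $V_t = \{x_{t,0}\}$, in which two distinct vertices $x_{i,j}$, $x_{i',j'}$ are adjacent if and only if $|i-i'|\le 1$ or $\{x_{i,j},x_{i',j'}\} = \{x_{s(l),0},x_{s(l+1),0}\}$ for some $0\le l\le r-1$. Let $m = r(r+2)$, and let $G$ be the graph obtained from $m^r+1$ copies of $X_{r,\kappa}$ by identifying the vertices of $V_0$ as common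 in every copy. Then $G$ is a finite, $\kappa$-connected, bridgeless graph of radius $r$, its centre is $\{x_{0,0}\}$, and $$rc(G) = m = r(r+2).$$ Consequently the upper bound $r(r+2)$ on the rainbow connection number of bridgeless graphs of radius $r$ cannot be improved under stronger connectivity: for all integers $\kappa, r\ge 1$, if an integer $B \ge 0$ satisfies $rc(H)\le B$ for every finite bridgeless $\kappa$-connected graph $H$ of radius $r$, then $B\ge r(r+2)$. -/

import Mathlib

/-- An edge colouring of `G` makes a walk `p` of `G` *rainbow* if no two different edges of `p`
have the same colour. -/
def SimpleGraph.EdgeLabeling.IsRainbow {V K : Type*} {G : SimpleGraph V} (c : G.EdgeLabeling K)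
    {u v : V} (p : G.Walk u v) : Prop :=
  ∀ (e e' : Sym2 V) (he : e ∈ p.edges) (he' : e' ∈ p.edges),
    c ⟨e, p.edges_subset_edgeSet he⟩ = c ⟨e', p.edges_subset_edgeSet he'⟩ → e = e'

/-- A rainbow colouring: any two vertices are joined by a rainbow path. -/
def SimpleGraph.EdgeLabeling.IsRainbowColouring {V K : Type*} {G : SimpleGraph V}
    (c : G.EdgeLabeling K) : Prop :=
  ∀ u v : V, ∃ p : G.Walk u v, p.IsPath ∧ c.IsRainbow p

/-- The rainbow connection number: the least `n` such that `G` has a rainbow colouring with `n`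
colours. (The value for graphs without any such colouring, e.g. disconnected ones, is `0`.) -/
noncomputable def SimpleGraph.rainbowConnectionNumber {V : Type*} (G : SimpleGraph V) : ℕ :=
  sInf {n : ℕ | ∃ c : G.EdgeLabeling (Fin n), c.IsRainbowColouring}

/-- `k`-vertex-connectivity: more than `k` vertices, and removing fewer than `k` vertices always
leaves a connected graph. -/
def SimpleGraph.IsVertexConnected {V : Type*} (G : SimpleGraph V) (k : ℕ) : Prop :=
  (k : ℕ∞) < ENat.card V ∧
    ∀ S : Finset V, S.card < k → (G.induce ((S : Set V)ᶜ)).Connected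

/-- A connected graph without bridges. -/
def SimpleGraph.IsBridgeless {V : Type*} (G : SimpleGraph V) : Prop :=
  G.Connected ∧ ∀ e ∈ G.edgeSet, ¬ G.IsBridge e

section Gluing

/-- The vertices obtained from the disjoint copies `W × {j}`, `j : ι`, by identifying, for each
`w` satisfying `A`, all the copies of `w`: one vertex for each `w` in `A`, and one vertex for each
`j` and each `w` not in `A`. -/
abbrev GluedVertex {W : Type*} (ι : Type*) (A : W → Prop) : Type _ :=
  {w : W // A w} ⊕ (ι × {w : W // ¬ A w})

/-- The vertex of the glued graph that is the image of the vertex `w` of the `j`-th copy. -/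
def gluedCopy {W ι : Type*} (A : W → Prop) [DecidablePred A] (j : ι) (w : W) : GluedVertex ι A :=
  if h : A w then Sum.inl ⟨w, h⟩ else Sum.inr (j, ⟨w, h⟩)

theorem gluedCopy_injective {W ι : Type*} (A : W → Prop) [DecidablePred A] (j : ι) :
    Function.Injective (gluedCopy A j) := by
  intro x y h
  unfold gluedCopy at h
  split_ifs at h <;> simpa using h

/-- The graph obtained from copies of `X`, one for each `j : ι`, by identifying the vertices that
satisfy `A` as common in every copy. -/
def gluedGraph {W : Type*} (X : SimpleGraph W) (ι : Type*) (A : W → Prop) [DecidablePred A] :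
    SimpleGraph (GluedVertex ι A) where
  Adj u v := ∃ (j : ι) (x y : W), X.Adj x y ∧ gluedCopy A j x = u ∧ gluedCopy A j y = v
  symm := ⟨by
    rintro u v ⟨j, x, y, h, hx, hy⟩
    exact ⟨j, y, x, h.symm, hy, hx⟩⟩
  loopless := ⟨by
    rintro u ⟨j, x, y, h, hx, hy⟩
    exact h.ne (gluedCopy_injective A j (hx.trans hy.symm))⟩

end Gluing

section Layered

/-- `s(i) = 2 (r + (r - 1) + ⋯ + (r - i + 1))`, used for `0 ≤ i ≤ r`; so `s(0) = 0`. -/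
def layerIndex (r i : ℕ) : ℕ := 2 * ∑ j ∈ Finset.Icc (r - i + 1) r, j

/-- The index `t = s(r) = r (r + 1)` of the last layer. -/
abbrev lastLayer (r : ℕ) : ℕ := r * (r + 1)

theorem layerIndex_self (r : ℕ) : layerIndex r r = lastLayer r := by
  induction r with
  | zero => rfl
  | succ n ih =>
    simp only [layerIndex, lastLayer, Nat.sub_self, Nat.zero_add] at ih ⊢
    rw [Finset.sum_Icc_succ_top (by omega), mul_add, ih]
    ring

/-- The vertices `x_{i,j}` of the layered graph, as pairs `(i, j)`: `0 ≤ i ≤ t`, `0 ≤ j < κ`, and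
`j = 0` if `i = t`. -/
abbrev LayeredVertex (r κ : ℕ) : Type :=
  {p : Fin (lastLayer r + 1) × Fin κ // (p.1 : ℕ) = lastLayer r → (p.2 : ℕ) = 0}

/-- The layer `i` of the vertex `x_{i,j}`. -/
def LayeredVertex.layer {r κ : ℕ} (x : LayeredVertex r κ) : ℕ := x.1.1

/-- The position `j` of the vertex `x_{i,j}` in its layer. -/
def LayeredVertex.pos {r κ : ℕ} (x : LayeredVertex r κ) : ℕ := x.1.2

/-- The layered graph `X_{r,κ}`: two different vertices in equal or consecutive layers are
adjacent, and so are `x_{s(i),0}` and `x_{s(i+1),0}` for `0 ≤ i ≤ r - 1`. -/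
def layeredGraph (r κ : ℕ) : SimpleGraph (LayeredVertex r κ) where
  Adj x y := x ≠ y ∧
    ((x.layer ≤ y.layer + 1 ∧ y.layer ≤ x.layer + 1) ∨
      (x.pos = 0 ∧ y.pos = 0 ∧ ∃ i < r,
        (x.layer = layerIndex r i ∧ y.layer = layerIndex r (i + 1)) ∨
        (y.layer = layerIndex r i ∧ x.layer = layerIndex r (i + 1))))
  symm := ⟨by
    rintro x y ⟨hne, h | ⟨hx, hy, i, hi, h⟩⟩
    · exact ⟨hne.symm, Or.inl h.symm⟩
    · exact ⟨hne.symm, Or.inr ⟨hy, hx, i, hi, h.symm⟩⟩⟩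
  loopless := ⟨fun _ h => h.1 rfl⟩

/-- Membership in the layer `V_0`. -/
abbrev InLayerZero {r κ : ℕ} (x : LayeredVertex r κ) : Prop := (x.1.1 : ℕ) = 0

/-- The vertices of `tightGraph r κ`. -/
abbrev TightVertex (r κ : ℕ) : Type :=
  GluedVertex (Fin ((r * (r + 2)) ^ r + 1)) (InLayerZero (r := r) (κ := κ))

/-- With `m = r (r + 2)`, the graph made of `m ^ r + 1` copies of `X_{r,κ}` by identifying the
vertices in `V_0` as common in every copy. -/
def tightGraph (r κ : ℕ) : SimpleGraph (TightVertex r κ) :=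
  gluedGraph (layeredGraph r κ) (Fin ((r * (r + 2)) ^ r + 1)) InLayerZero

/-- The common vertex `x_{0,0}` of all the copies. -/
def tightRoot (r κ : ℕ) (hκ : 1 ≤ κ) : TightVertex r κ :=
  Sum.inl ⟨⟨(0, ⟨0, hκ⟩), fun _ => rfl⟩, rfl⟩

end Layered

/-! ### The layers `s(i)` -/

/-! Everything rests on the gaps `s(i+1) - s(i) = 2 (r - i)`. From the root, `i` shortcuts reach
`x_{s(i),0}`. A vertex between two consecutive shortcut ends is then within `r - i` of the lower end
or within `r - i - 1` of the upper one, so the root has eccentricity at most `r`. The function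
`towardsCopy` changes by at most one along edges and bounds distances from below. It gives equality
at the root, and eccentricity above `r` at every other vertex, since some copy can only be entered
from such a vertex with one step to spare.

For `rc ≤ m`, an ordinary edge is coloured by its lower layer and the `i`-th shortcut by `t + i`,
which makes `t + r = m` colours. The root reaches a vertex of layer `k ≥ 1` both with colours below
`k` (layer by layer) and with colours at least `k` (shortcuts past the vertex, then back), so two
such vertices are joined through the root by combining a low walk with a high one. The same walks
count distances and avoid prospective bridges (`HasRainbowWalk.edist_le`,
`HasRainbowWalk.not_isBridge`).

For `rc ≥ m`, fewer than `m` colours give two of the `m ^ r + 1` copies the same colours on their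
`r` shortcuts. A rainbow path between the last layers of these copies uses each shortcut in at most
one of them. For each `i`, the copy that avoids the `i`-th shortcut contributes an edge for every
layer from `s(i)` up to `s(i+1) - 1`, in total `t` edges, and the other copy contributes at least
one more, in total `r` (`le_card_of_injOn_edges`). -/

theorem layerIndex_zero (r : ℕ) : layerIndex r 0 = 0 := by
  simp [layerIndex]

theorem layerIndex_succ {r i : ℕ} (hi : i < r) :
    layerIndex r (i + 1) = layerIndex r i + 2 * (r - i) := by
  have h : Finset.Icc (r - (i + 1) + 1) r = insert (r - i) (Finset.Icc (r - i + 1) r) := by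
    ext k
    simp only [Finset.mem_Icc, Finset.mem_insert]
    omega
  rw [layerIndex, layerIndex, h, Finset.sum_insert (by simp)]
  ring

theorem layerIndex_mono {r i j : ℕ} (hij : i ≤ j) (hj : j ≤ r) :
    layerIndex r i ≤ layerIndex r j := by
  induction j, hij using Nat.le_induction with
  | base => exact le_rfl
  | succ k hk ih =>
    have := ih (by omega)
    rw [layerIndex_succ (by omega)]
    omega

theorem layerIndex_lt {r i j : ℕ} (hij : i < j) (hj : j ≤ r) :
    layerIndex r i < layerIndex r j := by
  have h := layerIndex_mono (Nat.succ_le_of_lt hij) hj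
  rw [Nat.succ_eq_add_one, layerIndex_succ (by omega)] at h
  omega

theorem layerIndex_le_lastLayer {r i : ℕ} (hi : i ≤ r) : layerIndex r i ≤ lastLayer r :=
  layerIndex_self r ▸ layerIndex_mono hi le_rfl

/-- The greatest `i ≤ r` such that `s(i) ≤ k`. -/
def levelOf (r k : ℕ) : ℕ := Nat.findGreatest (fun i => layerIndex r i ≤ k) r

theorem levelOf_le (r k : ℕ) : levelOf r k ≤ r := Nat.findGreatest_le r

theorem layerIndex_levelOf_le (r k : ℕ) : layerIndex r (levelOf r k) ≤ k :=
  Nat.findGreatest_spec (P := fun i => layerIndex r i ≤ k) (Nat.zero_le r)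
    (by simp [layerIndex_zero])

theorem le_levelOf {r i k : ℕ} (hi : i ≤ r) (h : layerIndex r i ≤ k) : i ≤ levelOf r k :=
  Nat.le_findGreatest hi h

theorem lt_layerIndex_levelOf_succ {r k : ℕ} (h : levelOf r k < r) :
    k < layerIndex r (levelOf r k + 1) := by
  by_contra! hk
  have := le_levelOf h hk
  omega

theorem levelOf_eq {r i k : ℕ} (hi : i < r) (h : layerIndex r i ≤ k)
    (h' : k < layerIndex r (i + 1)) : levelOf r k = i := by
  refine le_antisymm ?_ (le_levelOf hi.le h)
  by_contra! hlt
  have := layerIndex_mono (Nat.succ_le_of_lt hlt) (levelOf_le r k)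
  have := layerIndex_levelOf_le r k
  simp only [Nat.succ_eq_add_one] at *
  omega

theorem levelOf_layerIndex {r i : ℕ} (hi : i ≤ r) : levelOf r (layerIndex r i) = i := by
  refine le_antisymm ?_ (le_levelOf hi le_rfl)
  by_contra! hlt
  have := layerIndex_lt hlt (levelOf_le r _)
  have := layerIndex_levelOf_le r (layerIndex r i)
  omega

theorem levelOf_lastLayer (r : ℕ) : levelOf r (lastLayer r) = r := by
  rw [← layerIndex_self, levelOf_layerIndex le_rfl]

theorem levelOf_lt {r k : ℕ} (hk : k < lastLayer r) : levelOf r k < r := by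
  refine lt_of_le_of_ne (levelOf_le r k) fun h => ?_
  have := layerIndex_levelOf_le r k
  rw [h, layerIndex_self] at this
  omega

theorem levelOf_mono {r k k' : ℕ} (h : k ≤ k') : levelOf r k ≤ levelOf r k' :=
  le_levelOf (levelOf_le r k) ((layerIndex_levelOf_le r k).trans h)

theorem levelOf_succ_le (r k : ℕ) : levelOf r (k + 1) ≤ levelOf r k + 1 := by
  by_contra! h
  have h1 := levelOf_le r (k + 1)
  have h2 := lt_layerIndex_levelOf_succ (r := r) (k := k) (by omega)
  have h3 := layerIndex_lt h h1
  have h4 := layerIndex_levelOf_le r (k + 1)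
  omega

theorem levelOf_zero {r : ℕ} : levelOf r 0 = 0 := by
  simpa [layerIndex_zero] using levelOf_layerIndex (Nat.zero_le r)

theorem levelOf_one {r : ℕ} (hr : 1 ≤ r) : levelOf r 1 = 0 := by
  refine levelOf_eq hr (by simp [layerIndex_zero]) ?_
  rw [layerIndex_succ hr, layerIndex_zero]
  omega

/-- The gap is at least 2, so a shortcut never joins consecutive layers; this is what lets the
colouring recognise shortcuts from layers alone. -/
theorem layerIndex_add_one_lt {r i : ℕ} (hi : i < r) :
    layerIndex r i + 1 < layerIndex r (i + 1) := by
  rw [layerIndex_succ hi]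
  omega

/-! ### The layered graph -/

namespace LayeredVertex

variable {r κ : ℕ}

theorem layer_le (x : LayeredVertex r κ) : LayeredVertex.layer x ≤ lastLayer r :=
  Nat.lt_succ_iff.mp x.1.1.2

theorem ext_layer_pos {x y : LayeredVertex r κ} (h : LayeredVertex.layer x = LayeredVertex.layer y)
    (h' : LayeredVertex.pos x = LayeredVertex.pos y) : x = y :=
  Subtype.ext (Prod.ext (Fin.ext h) (Fin.ext h'))

theorem pos_eq_zero {x : LayeredVertex r κ} (h : LayeredVertex.layer x = lastLayer r) :
    LayeredVertex.pos x = 0 := x.2 h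

/-- The vertex `x_{k,0}` (or `x_{t,0}`, if `k > t`). -/
def spine (r : ℕ) {κ : ℕ} (hκ : 1 ≤ κ) (k : ℕ) : LayeredVertex r κ :=
  ⟨(⟨min k (lastLayer r), by omega⟩, ⟨0, hκ⟩), fun _ => rfl⟩

theorem layer_spine (hκ : 1 ≤ κ) {k : ℕ} (hk : k ≤ lastLayer r) :
    LayeredVertex.layer (spine r hκ k) = k := min_eq_left hk

theorem pos_spine (hκ : 1 ≤ κ) (k : ℕ) : LayeredVertex.pos (spine r hκ k) = 0 := rfl

theorem layer_spine_layerIndex (hκ : 1 ≤ κ) {i : ℕ} (hi : i ≤ r) :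
    LayeredVertex.layer (spine r hκ (layerIndex r i)) = layerIndex r i :=
  layer_spine hκ (layerIndex_le_lastLayer hi)

theorem eq_spine (hκ : 1 ≤ κ) {x : LayeredVertex r κ} {k : ℕ} (h : LayeredVertex.layer x = k)
    (h' : LayeredVertex.pos x = 0) : x = spine r hκ k :=
  ext_layer_pos (by rw [layer_spine hκ (h ▸ layer_le x), h]) h'

end LayeredVertex

open LayeredVertex (spine layer_spine pos_spine layer_spine_layerIndex eq_spine)

theorem layeredGraph_adj_of_close {r κ : ℕ} {x y : LayeredVertex r κ} (h : x ≠ y)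
    (h₁ : LayeredVertex.layer x ≤ LayeredVertex.layer y + 1)
    (h₂ : LayeredVertex.layer y ≤ LayeredVertex.layer x + 1) : (layeredGraph r κ).Adj x y :=
  ⟨h, Or.inl ⟨h₁, h₂⟩⟩

theorem layeredGraph_adj_of_succ {r κ : ℕ} {x y : LayeredVertex r κ}
    (h : LayeredVertex.layer y = LayeredVertex.layer x + 1) : (layeredGraph r κ).Adj x y :=
  layeredGraph_adj_of_close (fun e => by simp [e] at h) (by omega) (by omega)

theorem layeredGraph_adj_spine {r κ : ℕ} (hκ : 1 ≤ κ) {i : ℕ} (hi : i < r) :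
    (layeredGraph r κ).Adj (spine r hκ (layerIndex r i)) (spine r hκ (layerIndex r (i + 1))) := by
  have h₁ := layer_spine_layerIndex hκ hi.le
  have h₂ := layer_spine_layerIndex hκ (i := i + 1) hi
  refine ⟨fun e => ?_, Or.inr ⟨rfl, rfl, i, hi, Or.inl ⟨h₁, h₂⟩⟩⟩
  rw [e, h₂] at h₁
  have := layerIndex_add_one_lt hi
  omega

/-- An edge from a lower to a higher layer joins consecutive layers, or is a shortcut. -/
theorem layeredGraph_adj_of_lt {r κ : ℕ} (hκ : 1 ≤ κ) {x y : LayeredVertex r κ}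
    (h : (layeredGraph r κ).Adj x y) (hlt : LayeredVertex.layer x < LayeredVertex.layer y) :
    LayeredVertex.layer y = LayeredVertex.layer x + 1 ∨
      ∃ i < r, x = spine r hκ (layerIndex r i) ∧ y = spine r hκ (layerIndex r (i + 1)) := by
  obtain ⟨-, h | ⟨hx, hy, i, hi, h | h⟩⟩ := h
  · exact Or.inl (by omega)
  · exact Or.inr ⟨i, hi, eq_spine hκ h.1 hx, eq_spine hκ h.2 hy⟩
  · have := layerIndex_add_one_lt hi
    omega

/-! ### The tight graph -/

/-- The number of copies of the layered graph in the tight graph. -/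
abbrev numCopies (r : ℕ) : ℕ := (r * (r + 2)) ^ r + 1

/-- The image in the tight graph of the vertex `x` of the `j`-th copy of the layered graph. -/
abbrev tightCopy {r κ : ℕ} (j : Fin (numCopies r)) (x : LayeredVertex r κ) : TightVertex r κ :=
  gluedCopy InLayerZero j x

/-- The layer of a vertex of the tight graph. -/
def TightVertex.layer {r κ : ℕ} (v : TightVertex r κ) : ℕ :=
  Sum.elim (fun _ => 0) (fun p => LayeredVertex.layer p.2.1) v

section TightCopy

variable {r κ : ℕ}

theorem tightCopy_of_zero (j : Fin (numCopies r)) {x : LayeredVertex r κ}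
    (hx : LayeredVertex.layer x = 0) : tightCopy j x = Sum.inl ⟨x, hx⟩ :=
  dif_pos hx

theorem tightCopy_of_ne_zero (j : Fin (numCopies r)) {x : LayeredVertex r κ}
    (hx : LayeredVertex.layer x ≠ 0) : tightCopy j x = Sum.inr (j, ⟨x, hx⟩) :=
  dif_neg hx

theorem tightCopy_congr (i j : Fin (numCopies r)) {x : LayeredVertex r κ}
    (hx : LayeredVertex.layer x = 0) : tightCopy i x = tightCopy j x := by
  rw [tightCopy_of_zero i hx, tightCopy_of_zero j hx]

theorem layer_tightCopy (j : Fin (numCopies r)) (x : LayeredVertex r κ) :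
    TightVertex.layer (tightCopy j x) = LayeredVertex.layer x := by
  by_cases hx : LayeredVertex.layer x = 0
  · rw [tightCopy_of_zero j hx, hx]; rfl
  · rw [tightCopy_of_ne_zero j hx]; rfl

/-- Only `V_0` is shared, so a vertex outside it determines its copy. -/
theorem tightCopy_inj {i j : Fin (numCopies r)} {x y : LayeredVertex r κ}
    (h : tightCopy i x = tightCopy j y) (hx : LayeredVertex.layer x ≠ 0) : i = j ∧ x = y := by
  have hy : LayeredVertex.layer y ≠ 0 := by
    rwa [← layer_tightCopy j y, ← h, layer_tightCopy]
  rw [tightCopy_of_ne_zero i hx, tightCopy_of_ne_zero j hy] at h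
  have h' := Prod.ext_iff.mp (Sum.inr_injective h)
  exact ⟨h'.1, congrArg Subtype.val h'.2⟩

theorem exists_tightCopy_eq (v : TightVertex r κ) :
    ∃ (j : Fin (numCopies r)) (x : LayeredVertex r κ), tightCopy j x = v := by
  obtain ⟨x, hx⟩ | ⟨j, x, hx⟩ := v
  · exact ⟨0, x, tightCopy_of_zero 0 hx⟩
  · exact ⟨j, x, tightCopy_of_ne_zero j hx⟩

theorem tightGraph_adj_tightCopy (j : Fin (numCopies r)) {x y : LayeredVertex r κ}
    (h : (layeredGraph r κ).Adj x y) : (tightGraph r κ).Adj (tightCopy j x) (tightCopy j y) :=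
  ⟨j, x, y, h, rfl, rfl⟩

theorem tightCopy_spine_zero (hκ : 1 ≤ κ) (j : Fin (numCopies r)) :
    tightCopy j (spine r hκ 0) = tightRoot r κ hκ := by
  rw [tightCopy_of_zero j (layer_spine hκ (Nat.zero_le _)), tightRoot]
  congr

theorem tightCopy_eq_tightRoot (hκ : 1 ≤ κ) (j : Fin (numCopies r)) {x : LayeredVertex r κ}
    (h : LayeredVertex.layer x = 0) (h' : LayeredVertex.pos x = 0) :
    tightCopy j x = tightRoot r κ hκ := by
  rw [eq_spine hκ h h', tightCopy_spine_zero]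

end TightCopy

/-! ### Walks with differently coloured edges -/

/-- The vertices `u` and `v` of `G` are joined by a walk whose edges have pairwise different
colours, all of them in `S`. -/
def HasRainbowWalk {V : Type*} (G : SimpleGraph V) (c : Sym2 V → ℕ) (S : Set ℕ) (u v : V) : Prop :=
  ∃ p : G.Walk u v, (p.edges.map c).Nodup ∧ ∀ e ∈ p.edges, c e ∈ S

namespace HasRainbowWalk

variable {V : Type*} {G : SimpleGraph V} {c : Sym2 V → ℕ} {S T : Set ℕ} {u v w : V}

theorem refl (v : V) : HasRainbowWalk G c S v v :=
  ⟨.nil, by simp⟩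

theorem of_adj (h : G.Adj u v) (hS : c s(u, v) ∈ S) : HasRainbowWalk G c S u v :=
  ⟨h.toWalk, by simpa using hS⟩

theorem mono (h : HasRainbowWalk G c S u v) (hST : S ⊆ T) : HasRainbowWalk G c T u v := by
  obtain ⟨p, hp, hS⟩ := h
  exact ⟨p, hp, fun e he => hST (hS e he)⟩

theorem symm (h : HasRainbowWalk G c S u v) : HasRainbowWalk G c S v u := by
  obtain ⟨p, hp, hS⟩ := h
  refine ⟨p.reverse, ?_, ?_⟩
  · rwa [SimpleGraph.Walk.edges_reverse, List.map_reverse, List.nodup_reverse]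
  · simpa using hS

theorem trans (h : HasRainbowWalk G c S u v) (h' : HasRainbowWalk G c T v w)
    (hST : Disjoint S T) : HasRainbowWalk G c (S ∪ T) u w := by
  obtain ⟨p, hp, hS⟩ := h
  obtain ⟨q, hq, hT⟩ := h'
  refine ⟨p.append q, ?_, ?_⟩
  · rw [SimpleGraph.Walk.edges_append, List.map_append, List.nodup_append']
    refine ⟨hp, hq, ?_⟩
    rw [List.disjoint_left]
    intro a ha hb
    obtain ⟨e, he, rfl⟩ := List.mem_map.mp ha
    obtain ⟨e', he', h'⟩ := List.mem_map.mp hb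
    exact Set.disjoint_left.mp hST (hS e he) (h' ▸ hT e' he')
  · intro e he
    rw [SimpleGraph.Walk.edges_append, List.mem_append] at he
    exact he.imp (hS e) (hT e)

theorem reachable (h : HasRainbowWalk G c S u v) : G.Reachable u v := ⟨h.choose⟩

/-- Distinct colours from `S` bound the length of the walk, so the colouring also serves to count
distances. -/
theorem edist_le {S : Finset ℕ} (h : HasRainbowWalk G c S u v) : G.edist u v ≤ S.card := by
  obtain ⟨p, hp, hS⟩ := h
  refine p.edist_le.trans (Nat.cast_le.mpr ?_)
  rw [← p.length_edges, ← List.length_map (f := c), ← List.toFinset_card_of_nodup hp]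
  refine Finset.card_le_card fun a ha => ?_
  obtain ⟨e, he, rfl⟩ := List.mem_map.mp (List.mem_toFinset.mp ha)
  exact hS e he

/-- A walk that misses the colour of an edge misses the edge. -/
theorem not_isBridge (h : HasRainbowWalk G c S u v) (hS : c s(u, v) ∉ S) :
    ¬ G.IsBridge s(u, v) := by
  obtain ⟨p, -, hp⟩ := h
  rw [SimpleGraph.isBridge_iff_forall_walk_mem_edges]
  exact fun hb => hS (hp _ (hb p))

end HasRainbowWalk

theorem SimpleGraph.not_isBridge_of_common_neighbor {V : Type*} {G : SimpleGraph V} {u v w : V}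
    (hu : G.Adj u w) (hv : G.Adj w v) : ¬ G.IsBridge s(u, v) := by
  rw [SimpleGraph.isBridge_iff_forall_walk_mem_edges]
  intro h
  have := h (.cons hu (.cons hv .nil))
  have h₁ := hu.ne
  have h₂ := hv.ne
  simp only [Walk.edges_cons, Walk.edges_nil, List.mem_cons, Sym2.eq_iff, List.not_mem_nil] at this
  grind

/-! ### The colouring of the tight graph -/

/-- The colour of an edge between vertices in layers `a ≤ b`: this is `a` unless `b > a + 1`, and
then it is `t` plus the number of the shortcut that begins in layer `a`. -/
def layerColour (r a b : ℕ) : ℕ :=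
  if max a b ≤ min a b + 1 then min a b else lastLayer r + levelOf r (min a b)

/-- The colouring of the edges of the tight graph by `r * (r + 2)` colours. -/
def tightColour (r κ : ℕ) (e : Sym2 (TightVertex r κ)) : ℕ :=
  Sym2.lift ⟨fun u v => layerColour r (TightVertex.layer u) (TightVertex.layer v), fun u v => by
    simp only [layerColour, max_comm, min_comm]⟩ e

section TightColour

variable {r κ : ℕ}

theorem tightColour_mk (u v : TightVertex r κ) :
    tightColour r κ s(u, v) = layerColour r (TightVertex.layer u) (TightVertex.layer v) := rfl

theorem layerColour_succ (r a : ℕ) : layerColour r a (a + 1) = a := by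
  simp [layerColour]

theorem layerColour_layerIndex {r i : ℕ} (hi : i < r) :
    layerColour r (layerIndex r i) (layerIndex r (i + 1)) = lastLayer r + i := by
  have h := layerIndex_add_one_lt hi
  rw [layerColour, min_eq_left (by omega), max_eq_right (by omega), if_neg (by omega),
    levelOf_layerIndex hi.le]

theorem layerColour_comm (r a b : ℕ) : layerColour r a b = layerColour r b a := by
  simp only [layerColour, max_comm, min_comm]

theorem tightColour_lt (hκ : 1 ≤ κ) (hr : 1 ≤ r) {e : Sym2 (TightVertex r κ)}
    (he : e ∈ (tightGraph r κ).edgeSet) : tightColour r κ e < r * (r + 2) := by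
  have hm : r * (r + 2) = lastLayer r + r := by rw [lastLayer]; ring
  induction e with | h u v =>
  obtain ⟨j, x, y, h, rfl, rfl⟩ := he
  rw [tightColour_mk, layer_tightCopy, layer_tightCopy, hm]
  wlog hxy : LayeredVertex.layer x ≤ LayeredVertex.layer y generalizing x y
  · rw [layerColour_comm]
    exact this y x h.symm (by omega)
  rcases hxy.eq_or_lt with hxy | hxy
  · have := LayeredVertex.layer_le x
    rw [← hxy, layerColour, if_pos (by omega), min_self]
    omega
  · rcases layeredGraph_adj_of_lt hκ h hxy with h | ⟨i, hi, rfl, rfl⟩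
    · have := LayeredVertex.layer_le x
      rw [h, layerColour_succ]
      omega
    · rw [layer_spine_layerIndex hκ hi.le, layer_spine_layerIndex hκ hi, layerColour_layerIndex hi]
      omega

/-- Vertices of different layers in one copy are joined by a walk through consecutive layers. -/
theorem hasRainbowWalk_of_layer_lt (hκ : 1 ≤ κ) (j : Fin (numCopies r)) {x y : LayeredVertex r κ}
    (h : LayeredVertex.layer x < LayeredVertex.layer y) :
    HasRainbowWalk (tightGraph r κ) (tightColour r κ)
      (Set.Ico (LayeredVertex.layer x) (LayeredVertex.layer y)) (tightCopy j x) (tightCopy j y) := by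
  obtain ⟨d, hd⟩ := Nat.exists_eq_add_of_lt h
  induction d generalizing x with
  | zero =>
    refine .of_adj (tightGraph_adj_tightCopy j (layeredGraph_adj_of_succ hd)) ?_
    rw [tightColour_mk, layer_tightCopy, layer_tightCopy, hd, layerColour_succ, Set.mem_Ico]
    omega
  | succ d ih =>
    have hz := layer_spine (r := r) hκ (k := LayeredVertex.layer x + 1)
      (by have := LayeredVertex.layer_le y; omega)
    have h₁ : HasRainbowWalk (tightGraph r κ) (tightColour r κ) {LayeredVertex.layer x}
        (tightCopy j x) (tightCopy j (spine r hκ (LayeredVertex.layer x + 1))) := by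
      refine .of_adj (tightGraph_adj_tightCopy j (layeredGraph_adj_of_succ hz)) ?_
      rw [tightColour_mk, layer_tightCopy, layer_tightCopy, hz, layerColour_succ]
      rfl
    have h₂ := ih (x := spine r hκ (LayeredVertex.layer x + 1)) (by omega) (by omega)
    rw [hz] at h₂
    refine (h₁.trans h₂ ?_).mono ?_
    · simp
    · rintro k (rfl | ⟨hk, hk'⟩)
      · exact ⟨le_rfl, h⟩
      · exact ⟨by omega, hk'⟩

/-- The walk along the shortcuts of one copy. -/
theorem hasRainbowWalk_root_spine (hκ : 1 ≤ κ) (j : Fin (numCopies r)) {i : ℕ} (hi : i ≤ r) :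
    HasRainbowWalk (tightGraph r κ) (tightColour r κ) (Set.Ico (lastLayer r) (lastLayer r + i))
      (tightRoot r κ hκ) (tightCopy j (spine r hκ (layerIndex r i))) := by
  induction i with
  | zero => rw [layerIndex_zero, tightCopy_spine_zero]; exact .refl _
  | succ i ih =>
    have h : HasRainbowWalk (tightGraph r κ) (tightColour r κ) {lastLayer r + i}
        (tightCopy j (spine r hκ (layerIndex r i)))
        (tightCopy j (spine r hκ (layerIndex r (i + 1)))) := by
      refine .of_adj (tightGraph_adj_tightCopy j (layeredGraph_adj_spine hκ hi)) ?_
      rw [tightColour_mk, layer_tightCopy, layer_tightCopy,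
        layer_spine_layerIndex hκ (Nat.le_of_succ_le hi), layer_spine_layerIndex hκ hi,
        layerColour_layerIndex hi]
      rfl
    refine ((ih (by omega)).trans h (by simp)).mono ?_
    rintro k (⟨hk, hk'⟩ | rfl)
    · exact ⟨hk, by omega⟩
    · exact ⟨by omega, by omega⟩

/-- The walk from the root to a vertex that follows the shortcuts to a layer above the vertex. -/
theorem hasRainbowWalk_root_of_layer_lt (hκ : 1 ≤ κ) (j : Fin (numCopies r))
    {x : LayeredVertex r κ} {i : ℕ} (hi : i ≤ r) (hx : LayeredVertex.layer x < layerIndex r i) :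
    HasRainbowWalk (tightGraph r κ) (tightColour r κ)
      (Set.Ico (lastLayer r) (lastLayer r + i) ∪ Set.Ico (LayeredVertex.layer x) (layerIndex r i))
      (tightRoot r κ hκ) (tightCopy j x) := by
  have hs := layer_spine_layerIndex (r := r) hκ hi
  have h := hasRainbowWalk_of_layer_lt hκ j (x := x) (y := spine r hκ (layerIndex r i))
    (by rwa [hs])
  rw [hs] at h
  refine (hasRainbowWalk_root_spine hκ j hi).trans h.symm ?_
  have := layerIndex_le_lastLayer hi
  rw [Set.disjoint_left]
  rintro k ⟨hk, -⟩ ⟨-, hk'⟩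
  omega

/-- The shortcuts overshoot to the first `s(i)` above `x`, with colours at least `t`; the descent
from there uses no layer below that of `x`. -/
theorem hasRainbowWalk_root_Ici (hκ : 1 ≤ κ) (j : Fin (numCopies r)) (x : LayeredVertex r κ) :
    HasRainbowWalk (tightGraph r κ) (tightColour r κ) (Set.Ici (LayeredVertex.layer x))
      (tightRoot r κ hκ) (tightCopy j x) := by
  rcases (LayeredVertex.layer_le x).eq_or_lt with hx | hx
  · have h := hasRainbowWalk_root_spine hκ j (le_refl r)
    rw [layerIndex_self, ← eq_spine hκ hx (LayeredVertex.pos_eq_zero hx)] at h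
    exact h.mono fun k hk => hx ▸ hk.1
  · have hi := levelOf_lt hx
    refine (hasRainbowWalk_root_of_layer_lt hκ j hi (lt_layerIndex_levelOf_succ hi)).mono ?_
    rintro k (⟨hk, -⟩ | ⟨hk, -⟩)
    · exact hx.le.trans hk
    · exact hk

/-- The walk climbs layer by layer. The hypothesis excludes the vertices of `V_0` other than the
root, for which no colours would be available. -/
theorem hasRainbowWalk_root_Iio (hκ : 1 ≤ κ) (j : Fin (numCopies r)) {x : LayeredVertex r κ}
    (hx : LayeredVertex.layer x = 0 → LayeredVertex.pos x = 0) :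
    HasRainbowWalk (tightGraph r κ) (tightColour r κ) (Set.Iio (LayeredVertex.layer x))
      (tightRoot r κ hκ) (tightCopy j x) := by
  by_cases h : LayeredVertex.layer x = 0
  · rw [tightCopy_eq_tightRoot hκ j h (hx h)]
    exact .refl _
  · have hz := layer_spine (r := r) hκ (Nat.zero_le _)
    have := hasRainbowWalk_of_layer_lt hκ j (x := spine r hκ 0) (y := x) (by omega)
    rw [tightCopy_spine_zero] at this
    exact this.mono fun k hk => hk.2

theorem hasRainbowWalk_through_root (hκ : 1 ≤ κ) (i j : Fin (numCopies r))
    {x y : LayeredVertex r κ} (hx : LayeredVertex.layer x = 0 → LayeredVertex.pos x = 0)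
    (hxy : LayeredVertex.layer x ≤ LayeredVertex.layer y) :
    HasRainbowWalk (tightGraph r κ) (tightColour r κ)
      (Set.Iio (LayeredVertex.layer x) ∪ Set.Ici (LayeredVertex.layer y))
      (tightCopy i x) (tightCopy j y) := by
  refine (hasRainbowWalk_root_Iio hκ i hx).symm.trans (hasRainbowWalk_root_Ici hκ j y) ?_
  rw [Set.disjoint_left]
  intro k hk hk'
  exact absurd (hxy.trans hk') (not_le.mpr hk)

/-- Vertices outside `V_0` are joined through the root, the lower one by low colours. A vertex of
`V_0` lies in every copy, so it can be joined to the other vertex inside that vertex's own copy. -/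
theorem hasRainbowWalk_tightGraph (hκ : 1 ≤ κ) (u v : TightVertex r κ) :
    HasRainbowWalk (tightGraph r κ) (tightColour r κ) Set.univ u v := by
  obtain ⟨i, x, rfl⟩ := exists_tightCopy_eq u
  obtain ⟨j, y, rfl⟩ := exists_tightCopy_eq v
  wlog hxy : LayeredVertex.layer x ≤ LayeredVertex.layer y generalizing x y i j
  · exact (this j y i x (by omega)).symm
  by_cases hx : LayeredVertex.layer x = 0
  · rw [tightCopy_congr i j hx]
    rcases hxy.eq_or_lt with h | h
    · by_cases e : x = y
      · exact e ▸ .refl _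
      · exact .of_adj (tightGraph_adj_tightCopy j
          (layeredGraph_adj_of_close e (by omega) (by omega))) trivial
    · exact (hasRainbowWalk_of_layer_lt hκ j h).mono (Set.subset_univ _)
  · exact (hasRainbowWalk_through_root hκ i j (fun h => absurd h hx) hxy).mono (Set.subset_univ _)

end TightColour

theorem tightGraph_exists_isRainbowColouring {r κ : ℕ} (hκ : 1 ≤ κ) (hr : 1 ≤ r) :
    ∃ c : (tightGraph r κ).EdgeLabeling (Fin (r * (r + 2))), c.IsRainbowColouring := by
  classical
  refine ⟨fun e => ⟨tightColour r κ e.1, tightColour_lt hκ hr e.2⟩, fun u v => ?_⟩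
  obtain ⟨p, hp, -⟩ := hasRainbowWalk_tightGraph hκ u v
  refine ⟨p.bypass, p.bypass_isPath, fun e e' he he' h => ?_⟩
  exact List.inj_on_of_nodup_map hp (p.edges_bypass_subset_edges he)
    (p.edges_bypass_subset_edges he') (Fin.mk.inj h)

/-! ### Connectivity -/

section Connectivity

variable {r κ : ℕ}

theorem tightGraph_connected (hκ : 1 ≤ κ) : (tightGraph r κ).Connected :=
  (SimpleGraph.connected_iff _).mpr
    ⟨fun u v => (hasRainbowWalk_tightGraph hκ u v).reachable, ⟨tightRoot r κ hκ⟩⟩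

theorem tightGraph_isBridgeless (hκ : 1 ≤ κ) : (tightGraph r κ).IsBridgeless := by
  refine ⟨tightGraph_connected hκ, fun e he => ?_⟩
  induction e with | h u v =>
  obtain ⟨j, x, y, h, rfl, rfl⟩ := he
  wlog hxy : LayeredVertex.layer x ≤ LayeredVertex.layer y generalizing x y
  · rw [Sym2.eq_swap]
    exact this y x h.symm (by omega)
  rcases hxy.eq_or_lt with hxy | hxy
  -- `V_t` is a single vertex, so an edge inside a layer has a common neighbour in the next layer.
  · have hlt : LayeredVertex.layer x < lastLayer r := by
      refine lt_of_le_of_ne (LayeredVertex.layer_le x) fun hx => h.ne ?_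
      refine LayeredVertex.ext_layer_pos hxy ?_
      rw [LayeredVertex.pos_eq_zero hx, LayeredVertex.pos_eq_zero (hxy ▸ hx)]
    have hz := layer_spine (r := r) hκ (Nat.succ_le_of_lt hlt)
    exact SimpleGraph.not_isBridge_of_common_neighbor
      (tightGraph_adj_tightCopy j (layeredGraph_adj_of_succ hz))
      (tightGraph_adj_tightCopy j (layeredGraph_adj_of_succ (hxy ▸ hz)).symm)
  · rcases layeredGraph_adj_of_lt hκ h hxy with hs | ⟨i, hi, rfl, rfl⟩
    · by_cases hx : LayeredVertex.layer x = 0 → LayeredVertex.pos x = 0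
      -- The detour through the root misses exactly the colour of this edge, the layer of `x`.
      · refine (hasRainbowWalk_through_root hκ j j hx hxy.le).not_isBridge ?_
        rw [tightColour_mk, layer_tightCopy, layer_tightCopy, hs, layerColour_succ]
        simp
      · push Not at hx
        have hz := layer_spine (r := r) hκ (Nat.zero_le _)
        refine SimpleGraph.not_isBridge_of_common_neighbor (w := tightCopy j (spine r hκ 0))
          (tightGraph_adj_tightCopy j (layeredGraph_adj_of_close (fun e => hx.2 ?_) ?_ ?_))
          (tightGraph_adj_tightCopy j (layeredGraph_adj_of_succ ?_))
        · rw [e, pos_spine]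
        all_goals omega
    -- A shortcut has colour at least `t`, while the climb between its ends has colours below `t`.
    · refine (hasRainbowWalk_of_layer_lt hκ j hxy).not_isBridge ?_
      rw [tightColour_mk, layer_tightCopy, layer_tightCopy,
        layer_spine_layerIndex hκ hi.le, layer_spine_layerIndex hκ hi, layerColour_layerIndex hi]
      have := layerIndex_le_lastLayer (r := r) hi
      simp only [Set.mem_Ico, not_and, not_lt]
      omega

theorem tightGraph_exists_notMem_of_card_lt (j : Fin (numCopies r)) {k : ℕ} (hk : k < lastLayer r)
    {S : Finset (TightVertex r κ)} (hS : S.card < κ) :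
    ∃ x : LayeredVertex r κ, LayeredVertex.layer x = k ∧ tightCopy j x ∉ S := by
  classical
  let f : Fin κ → LayeredVertex r κ := fun a => ⟨(⟨k, by omega⟩, a), fun h => absurd h hk.ne⟩
  have hf : Function.Injective (fun a => tightCopy j (f a)) := by
    refine (gluedCopy_injective InLayerZero j).comp fun a b h => ?_
    exact congrArg (fun x : LayeredVertex r κ => x.1.2) h
  have hcard : S.card < (Finset.univ.image fun a => tightCopy j (f a)).card := by
    rwa [Finset.card_image_of_injective _ hf, Finset.card_fin]
  obtain ⟨v, hv, hvS⟩ := Finset.exists_mem_notMem_of_card_lt_card hcard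
  obtain ⟨a, -, rfl⟩ := Finset.mem_image.mp hv
  exact ⟨f a, rfl, hvS⟩

/-- Every layer below `t` keeps a vertex, so each survivor can descend to the clique `V_0`, which
all copies share. -/
theorem tightGraph_isVertexConnected (hκ : 1 ≤ κ) (hr : 1 ≤ r) :
    (tightGraph r κ).IsVertexConnected κ := by
  have ht : 0 < lastLayer r := by rw [lastLayer]; positivity
  refine ⟨?_, fun S hS => ?_⟩
  -- The `κ` vertices of `V_0` together with `x_{t,0}` make `κ + 1`.
  · let f : Option (Fin κ) → LayeredVertex r κ := fun o =>
      o.elim (spine r hκ (lastLayer r)) fun a => ⟨(⟨0, by omega⟩, a), fun h => absurd h ht.ne⟩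
    have hlast := layer_spine (r := r) hκ le_rfl
    have hf : Function.Injective f := by
      rintro (_ | a) (_ | b) h
      · rfl
      · exact absurd (hlast.symm.trans (congrArg LayeredVertex.layer h)) ht.ne'
      · exact absurd (hlast.symm.trans (congrArg LayeredVertex.layer h.symm)) ht.ne'
      · exact congrArg (fun x : LayeredVertex r κ => some x.1.2) h
    have hcard := ENat.card_le_card_of_injective ((gluedCopy_injective InLayerZero
      (0 : Fin (numCopies r))).comp hf)
    rw [ENat.card_eq_coe_fintype_card, Fintype.card_option, Fintype.card_fin] at hcard
    exact lt_of_lt_of_le (Nat.cast_lt.mpr (Nat.lt_succ_self κ)) hcard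
  · obtain ⟨z, hz, hzS⟩ := tightGraph_exists_notMem_of_card_lt 0 ht hS
    have key : ∀ (k : ℕ) (j : Fin (numCopies r)) (x : LayeredVertex r κ)
        (hxS : tightCopy j x ∈ ((S : Set (TightVertex r κ))ᶜ : Set _)),
        LayeredVertex.layer x = k →
        ((tightGraph r κ).induce ((S : Set (TightVertex r κ))ᶜ)).Reachable ⟨tightCopy j x, hxS⟩
          ⟨tightCopy 0 z, hzS⟩ := by
      intro k
      induction k with
      | zero =>
        intro j x hxS hx
        by_cases e : x = z
        · subst e
          simp only [tightCopy_congr j 0 hx]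
          exact .rfl
        · refine SimpleGraph.Adj.reachable ?_
          rw [SimpleGraph.induce_adj]
          simp only [tightCopy_congr j 0 hx]
          exact tightGraph_adj_tightCopy 0 (layeredGraph_adj_of_close e (by omega) (by omega))
      | succ k ih =>
        intro j x hxS hx
        obtain ⟨y, hy, hyS⟩ := tightGraph_exists_notMem_of_card_lt (k := k) j
          (by have := LayeredVertex.layer_le x; omega) hS
        refine SimpleGraph.Reachable.trans (SimpleGraph.Adj.reachable ?_) (ih j y hyS hy)
        rw [SimpleGraph.induce_adj]
        exact tightGraph_adj_tightCopy j (layeredGraph_adj_of_succ (by omega)).symm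
    refine (SimpleGraph.connected_iff _).mpr ⟨?_, ⟨⟨tightCopy 0 z, hzS⟩⟩⟩
    rintro ⟨u, hu⟩ ⟨v, hv⟩
    obtain ⟨i, x, rfl⟩ := exists_tightCopy_eq u
    obtain ⟨j, y, rfl⟩ := exists_tightCopy_eq v
    exact (key _ i x hu rfl).trans (key _ j y hv rfl).symm

end Connectivity

/-! ### Distances -/

section Distances

variable {r κ : ℕ}

theorem edist_tightRoot_le (hκ : 1 ≤ κ) (v : TightVertex r κ) :
    (tightGraph r κ).edist (tightRoot r κ hκ) v ≤ r := by
  obtain ⟨j, x, rfl⟩ := exists_tightCopy_eq v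
  have hi := levelOf_le r (LayeredVertex.layer x)
  have hle := layerIndex_levelOf_le r (LayeredVertex.layer x)
  have hlt := fun h => lt_layerIndex_levelOf_succ (r := r) (k := LayeredVertex.layer x) h
  generalize levelOf r (LayeredVertex.layer x) = i at hi hle hlt
  have hs := layer_spine_layerIndex (r := r) hκ hi
  have hroot : (tightGraph r κ).edist (tightRoot r κ hκ)
      (tightCopy j (spine r hκ (layerIndex r i))) ≤ i := by
    have h := hasRainbowWalk_root_spine hκ j hi
    rw [← Finset.coe_Ico] at h
    simpa using h.edist_le
  by_cases hxs : x = spine r hκ (layerIndex r i)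
  · exact hxs ▸ hroot.trans (Nat.cast_le.mpr hi)
  have hir : i < r := by
    refine lt_of_le_of_ne hi fun h => hxs ?_
    have hx := LayeredVertex.layer_le x
    rw [h, layerIndex_self] at hle
    rw [h, layerIndex_self]
    exact eq_spine hκ (by omega) (LayeredVertex.pos_eq_zero (by omega))
  have hlt := hlt hir
  rw [layerIndex_succ hir] at hlt
  -- Another vertex of layer `s(i)` costs one extra edge. A vertex at height `d` above `s(i)` costs
  -- `i + d` from below and `i + 1 + 2 (r - i) - d` from above; the first is at most `r` if `d ≤ r -
  -- i`, the second otherwise.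
  rcases hle.eq_or_lt with he | hl
  · have hadj : (tightGraph r κ).edist (tightCopy j (spine r hκ (layerIndex r i)))
        (tightCopy j x) ≤ 1 :=
      (SimpleGraph.edist_eq_one_iff_adj.mpr (tightGraph_adj_tightCopy j
        (layeredGraph_adj_of_close (Ne.symm hxs) (by omega) (by omega)))).le
    refine SimpleGraph.edist_triangle.trans ((add_le_add hroot hadj).trans ?_)
    exact_mod_cast hir
  by_cases hd : LayeredVertex.layer x ≤ layerIndex r i + (r - i)
  · have h := hasRainbowWalk_of_layer_lt hκ j (x := spine r hκ (layerIndex r i)) (y := x) (by omega)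
    rw [← Finset.coe_Ico] at h
    have h' := h.edist_le
    rw [Nat.card_Ico, hs] at h'
    refine SimpleGraph.edist_triangle.trans ((add_le_add hroot h').trans ?_)
    norm_cast
    omega
  · have h := hasRainbowWalk_root_of_layer_lt hκ j (x := x) (i := i + 1) hir
      (by rw [layerIndex_succ hir]; exact hlt)
    rw [← Finset.coe_Ico, ← Finset.coe_Ico, ← Finset.coe_union] at h
    refine h.edist_le.trans (Nat.cast_le.mpr ((Finset.card_union_le _ _).trans ?_))
    rw [Nat.card_Ico, Nat.card_Ico, layerIndex_succ hir]
    omega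

/-! ### Lower bounds for distances; radius and centre. -/

theorem SimpleGraph.Walk.le_add_length_of_adj {V : Type*} {G : SimpleGraph V} {h : V → ℕ}
    (hh : ∀ u v, G.Adj u v → h v ≤ h u + 1) {u v : V} (p : G.Walk u v) :
    h v ≤ h u + p.length := by
  induction p with
  | nil => simp
  | cons hadj p ih =>
    have := hh _ _ hadj
    rw [Walk.length_cons]
    omega

theorem SimpleGraph.le_edist_of_adj {V : Type*} {G : SimpleGraph V} {h : V → ℕ}
    (hh : ∀ u v, G.Adj u v → h v ≤ h u + 1) {u v : V} {d : ℕ} (hd : h u + d ≤ h v) :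
    (d : ℕ∞) ≤ G.edist u v := by
  refine le_iInf fun p => Nat.cast_le.mpr ?_
  have := p.le_add_length_of_adj hh
  omega

/-- A lower bound, up to an additive constant, for the distance from the root towards the last
layer of the copy `j`. -/
def towardsCopy (j : Fin (numCopies r)) : TightVertex r κ → ℕ :=
  Sum.elim (fun x => if LayeredVertex.pos x.1 = 0 then 1 else 0)
    fun p => if p.1 = j then levelOf r (LayeredVertex.layer p.2.1) + 1 else 0

theorem towardsCopy_tightCopy (i j : Fin (numCopies r)) (x : LayeredVertex r κ) :
    towardsCopy j (tightCopy i x) = if LayeredVertex.layer x = 0 then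
      (if LayeredVertex.pos x = 0 then 1 else 0)
      else if i = j then levelOf r (LayeredVertex.layer x) + 1 else 0 := by
  by_cases hx : LayeredVertex.layer x = 0
  · rw [tightCopy_of_zero i hx, if_pos hx]; rfl
  · rw [tightCopy_of_ne_zero i hx, if_neg hx]; rfl

/-- Inside copy `j` neither a step to the next layer nor a shortcut raises the level by more than
one. Copy `j` is entered from `V_0` at level 0 (value 1), or from the root by the first shortcut
(value 2); the root itself has value 1. -/
theorem towardsCopy_le_of_adj (hr : 1 ≤ r) (j : Fin (numCopies r)) (u v : TightVertex r κ)
    (h : (tightGraph r κ).Adj u v) : towardsCopy j v ≤ towardsCopy j u + 1 := by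
  obtain ⟨i, x, y, h, rfl, rfl⟩ := h
  change towardsCopy j (tightCopy i y) ≤ towardsCopy j (tightCopy i x) + 1
  rw [towardsCopy_tightCopy, towardsCopy_tightCopy]
  obtain ⟨-, ⟨h₁, h₂⟩ | ⟨hx, hy, l, hl, ⟨h₁, h₂⟩ | ⟨h₁, h₂⟩⟩⟩ := h
  · have hmono := levelOf_mono (r := r) h₂
    have hsucc := levelOf_succ_le r (LayeredVertex.layer x)
    by_cases hx0 : LayeredVertex.layer x = 0
    · have hy1 := levelOf_mono (r := r) (k := LayeredVertex.layer y) (k' := 1) (by omega)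
      rw [levelOf_one hr] at hy1
      split_ifs <;> omega
    · split_ifs <;> omega
  · have h₃ := levelOf_layerIndex (r := r) hl.le
    have h₄ := levelOf_layerIndex (r := r) (i := l + 1) hl
    rw [← h₁] at h₃
    rw [← h₂] at h₄
    have h₅ : LayeredVertex.layer x = 0 → l = 0 := fun h => by rw [← h₃, h, levelOf_zero]
    split_ifs <;> omega
  · have h₃ := levelOf_layerIndex (r := r) hl.le
    have h₄ := levelOf_layerIndex (r := r) (i := l + 1) hl
    rw [← h₁] at h₃
    rw [← h₂] at h₄
    have h₅ : LayeredVertex.layer x ≠ 0 := fun h => by simp [h, levelOf_zero] at h₄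
    split_ifs <;> omega

theorem towardsCopy_last (hκ : 1 ≤ κ) (hr : 1 ≤ r) (j : Fin (numCopies r)) :
    towardsCopy j (tightCopy j (spine r hκ (lastLayer r))) = r + 1 := by
  have : 0 < lastLayer r := by rw [lastLayer]; positivity
  rw [towardsCopy_tightCopy, layer_spine hκ le_rfl, if_neg this.ne', if_pos rfl, levelOf_lastLayer]

theorem exists_towardsCopy_eq_zero (hκ : 1 ≤ κ) (hr : 1 ≤ r) {u : TightVertex r κ}
    (hu : u ≠ tightRoot r κ hκ) : ∃ j : Fin (numCopies r), towardsCopy j u = 0 := by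
  obtain ⟨i, x, rfl⟩ := exists_tightCopy_eq u
  by_cases hx : LayeredVertex.layer x = 0
  · refine ⟨0, ?_⟩
    rw [towardsCopy_tightCopy, if_pos hx, if_neg]
    exact fun h => hu (tightCopy_eq_tightRoot hκ i hx h)
  -- A vertex outside `V_0` has value 0 for every copy but its own, and there are at least two
  -- copies.
  · have : Nontrivial (Fin (numCopies r)) := by
      rw [Fin.nontrivial_iff_two_le]
      have : 0 < (r * (r + 2)) ^ r := by positivity
      simp only [numCopies]
      omega
    obtain ⟨j, hj⟩ := exists_ne i
    exact ⟨j, by rw [towardsCopy_tightCopy, if_neg hx, if_neg hj.symm]⟩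

theorem eccent_tightRoot (hκ : 1 ≤ κ) (hr : 1 ≤ r) :
    (tightGraph r κ).eccent (tightRoot r κ hκ) = r := by
  refine le_antisymm ((SimpleGraph.eccent_le_iff _ _).mpr (edist_tightRoot_le hκ)) ?_
  refine le_trans ?_ (SimpleGraph.edist_le_eccent (v := tightCopy 0 (spine r hκ (lastLayer r))))
  refine SimpleGraph.le_edist_of_adj (towardsCopy_le_of_adj hr 0) ?_
  rw [towardsCopy_last hκ hr, ← tightCopy_spine_zero hκ 0, towardsCopy_tightCopy,
    layer_spine hκ (Nat.zero_le _), if_pos rfl, pos_spine, if_pos rfl]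
  omega

theorem lt_eccent_of_ne_tightRoot (hκ : 1 ≤ κ) (hr : 1 ≤ r) {u : TightVertex r κ}
    (hu : u ≠ tightRoot r κ hκ) : (r : ℕ∞) < (tightGraph r κ).eccent u := by
  obtain ⟨j, hj⟩ := exists_towardsCopy_eq_zero hκ hr hu
  refine lt_of_lt_of_le (Nat.cast_lt.mpr (Nat.lt_succ_self r)) (le_trans ?_
    (SimpleGraph.edist_le_eccent (v := tightCopy j (spine r hκ (lastLayer r)))))
  refine SimpleGraph.le_edist_of_adj (towardsCopy_le_of_adj hr j) ?_
  rw [towardsCopy_last hκ hr, hj]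
  omega

theorem tightGraph_radius (hκ : 1 ≤ κ) (hr : 1 ≤ r) : (tightGraph r κ).radius = r := by
  refine le_antisymm (SimpleGraph.radius_le_eccent.trans (eccent_tightRoot hκ hr).le) ?_
  refine le_iInf fun u => ?_
  by_cases hu : u = tightRoot r κ hκ
  · rw [hu, eccent_tightRoot hκ hr]
  · exact (lt_eccent_of_ne_tightRoot hκ hr hu).le

theorem tightGraph_center (hκ : 1 ≤ κ) (hr : 1 ≤ r) :
    (tightGraph r κ).center = {tightRoot r κ hκ} := by
  ext u
  rw [SimpleGraph.mem_center_iff, tightGraph_radius hκ hr, Set.mem_singleton_iff]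
  refine ⟨fun h => ?_, fun h => h ▸ eccent_tightRoot hκ hr⟩
  by_contra hu
  exact (lt_eccent_of_ne_tightRoot hκ hr hu).ne' h

end Distances

/-! ### The number of colours of a rainbow colouring -/

/-- The edge `e` leads upwards from layer `k` of the `j`-th copy. -/
def LeavesLayer {r κ : ℕ} (j : Fin (numCopies r)) (k : ℕ) (e : Sym2 (TightVertex r κ)) : Prop :=
  ∃ x y : LayeredVertex r κ, e = s(tightCopy j x, tightCopy j y) ∧
    LayeredVertex.layer x = k ∧ k < LayeredVertex.layer y

/-- The `i`-th shortcut of the `j`-th copy. -/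
def shortcutEdge (r : ℕ) {κ : ℕ} (hκ : 1 ≤ κ) (j : Fin (numCopies r)) (i : ℕ) :
    Sym2 (TightVertex r κ) :=
  s(tightCopy j (spine r hκ (layerIndex r i)), tightCopy j (spine r hκ (layerIndex r (i + 1))))

section Colours

variable {r κ : ℕ}

theorem LeavesLayer.unique {i j : Fin (numCopies r)} {k l : ℕ} {e : Sym2 (TightVertex r κ)}
    (h : LeavesLayer i k e) (h' : LeavesLayer j l e) : i = j ∧ k = l := by
  obtain ⟨x, y, rfl, rfl, hlt⟩ := h
  obtain ⟨x', y', he, rfl, hlt'⟩ := h'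
  rcases Sym2.eq_iff.mp he with ⟨h₁, h₂⟩ | ⟨h₁, h₂⟩
  · have hx := congrArg TightVertex.layer h₁
    rw [layer_tightCopy, layer_tightCopy] at hx
    exact ⟨(tightCopy_inj h₂ (by omega)).1, hx⟩
  · have hx := congrArg TightVertex.layer h₁
    have hy := congrArg TightVertex.layer h₂
    rw [layer_tightCopy, layer_tightCopy] at hx hy
    omega

theorem shortcutEdge_leavesLayer (hκ : 1 ≤ κ) (j : Fin (numCopies r)) {i : ℕ} (hi : i < r) :
    LeavesLayer j (layerIndex r i) (shortcutEdge r hκ j i) := by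
  refine ⟨_, _, rfl, layer_spine_layerIndex hκ hi.le, ?_⟩
  rw [layer_spine_layerIndex hκ hi]
  exact layerIndex_lt (Nat.lt_succ_self i) hi

theorem shortcutEdge_mem_edgeSet (hκ : 1 ≤ κ) (j : Fin (numCopies r)) {i : ℕ} (hi : i < r) :
    shortcutEdge r hκ j i ∈ (tightGraph r κ).edgeSet :=
  tightGraph_adj_tightCopy j (layeredGraph_adj_spine hκ hi)

/-- A walk that starts in the last layer of a copy and leaves the copy crosses every layer. -/
theorem exists_edge_across_layer (hκ : 1 ≤ κ) {j : Fin (numCopies r)} {v : TightVertex r κ}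
    (p : (tightGraph r κ).Walk (tightCopy j (spine r hκ (lastLayer r))) v)
    (hv : ∀ x : LayeredVertex r κ, 0 < LayeredVertex.layer x → tightCopy j x ≠ v)
    {k : ℕ} (hk : k < lastLayer r) :
    ∃ e ∈ p.edges, LeavesLayer j k e ∨
      ∃ i < r, levelOf r k = i ∧ e = shortcutEdge r hκ j i := by
  let A : Set (TightVertex r κ) :=
    {u | ∃ x : LayeredVertex r κ, k < LayeredVertex.layer x ∧ tightCopy j x = u}
  obtain ⟨d, hd, ⟨y, hy, hdy⟩, hdA⟩ := p.exists_boundary_dart A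
    ⟨_, by rwa [layer_spine hκ le_rfl], rfl⟩
    (by rintro ⟨x, hx, hxv⟩; exact hv x (by omega) hxv)
  obtain ⟨i, y', x, h, hy', hx⟩ := d.adj
  -- The upper end lies outside `V_0`, so the crossing edge belongs to copy `j`.
  obtain ⟨rfl, rfl⟩ := tightCopy_inj (hdy.trans hy'.symm) (by omega)
  have hxk : LayeredVertex.layer x ≤ k := by
    by_contra! hlt
    exact hdA ⟨x, hlt, hx⟩
  have he : d.edge = s(tightCopy j x, tightCopy j y) := by
    rw [SimpleGraph.dart_edge_eq_mk'_iff']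
    exact Or.inr ⟨hy'.symm, hx.symm⟩
  refine ⟨d.edge, List.mem_map_of_mem hd, ?_⟩
  rcases layeredGraph_adj_of_lt hκ h.symm (by omega) with hs | ⟨l, hl, rfl, rfl⟩
  · exact Or.inl ⟨x, y, he, by omega, hy⟩
  · rw [layer_spine_layerIndex hκ hl.le] at hxk
    rw [layer_spine_layerIndex hκ hl] at hy
    exact Or.inr ⟨l, hl, levelOf_eq hl hxk hy, he⟩

/-- The only shortcut that can cross above layer `s(i)` begins in that layer, so both ways of
crossing leave it. -/
theorem exists_leavesLayer_layerIndex (hκ : 1 ≤ κ) {j : Fin (numCopies r)} {v : TightVertex r κ}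
    (p : (tightGraph r κ).Walk (tightCopy j (spine r hκ (lastLayer r))) v)
    (hv : ∀ x : LayeredVertex r κ, 0 < LayeredVertex.layer x → tightCopy j x ≠ v)
    {i : ℕ} (hi : i < r) : ∃ e ∈ p.edges, LeavesLayer j (layerIndex r i) e := by
  obtain ⟨e, he, h | ⟨l, hl, hil, rfl⟩⟩ := exists_edge_across_layer hκ p hv
    (lt_of_lt_of_le (layerIndex_lt (Nat.lt_succ_self i) hi) (layerIndex_le_lastLayer hi))
  · exact ⟨e, he, h⟩
  · rw [levelOf_layerIndex hi.le] at hil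
    subst hil
    exact ⟨_, he, shortcutEdge_leavesLayer hκ j hi⟩

theorem exists_leavesLayer_of_shortcutEdge_notMem (hκ : 1 ≤ κ) {j : Fin (numCopies r)}
    {v : TightVertex r κ} (p : (tightGraph r κ).Walk (tightCopy j (spine r hκ (lastLayer r))) v)
    (hv : ∀ x : LayeredVertex r κ, 0 < LayeredVertex.layer x → tightCopy j x ≠ v)
    {k : ℕ} (hk : k < lastLayer r) (hp : shortcutEdge r hκ j (levelOf r k) ∉ p.edges) :
    ∃ e ∈ p.edges, LeavesLayer j k e := by
  obtain ⟨e, he, h | ⟨l, hl, rfl, rfl⟩⟩ := exists_edge_across_layer hκ p hv hk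
  · exact ⟨e, he, h⟩
  · exact absurd he hp

/-- A walk between the last layers of two copies that contains at most one of the two `i`-th
shortcuts, for each `i`, has at least `r * (r + 2)` different edges. -/
theorem le_card_of_injOn_edges (hκ : 1 ≤ κ) {a b : Fin (numCopies r)} (hab : a ≠ b)
    (p : (tightGraph r κ).Walk (tightCopy a (spine r hκ (lastLayer r)))
      (tightCopy b (spine r hκ (lastLayer r))))
    (hp : ∀ i < r, shortcutEdge r hκ a i ∈ p.edges → shortcutEdge r hκ b i ∉ p.edges)
    {n : ℕ} (c : {e // e ∈ p.edges} → Fin n) (hc : Function.Injective c) :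
    r * (r + 2) ≤ n := by
  classical
  have hva : ∀ x : LayeredVertex r κ, 0 < LayeredVertex.layer x →
      tightCopy a x ≠ tightCopy b (spine r hκ (lastLayer r)) :=
    fun x hx h => hab (tightCopy_inj h hx.ne').1
  have hvb : ∀ x : LayeredVertex r κ, 0 < LayeredVertex.layer x →
      tightCopy b x ≠ tightCopy a (spine r hκ (lastLayer r)) :=
    fun x hx h => hab (tightCopy_inj h hx.ne').1.symm
  -- In the copy `slow i` the walk avoids the `i`-th shortcut; `fast i` is the other copy.
  let slow : ℕ → Fin (numCopies r) := fun i => if shortcutEdge r hκ a i ∈ p.edges then b else a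
  let fast : ℕ → Fin (numCopies r) := fun i => if shortcutEdge r hκ a i ∈ p.edges then a else b
  have hslow : ∀ k : Fin (lastLayer r), ∃ e : {e // e ∈ p.edges},
      LeavesLayer (slow (levelOf r k)) k e.1 := by
    intro k
    by_cases h : shortcutEdge r hκ a (levelOf r k) ∈ p.edges
    · have h' := hp _ (levelOf_lt k.2) h
      obtain ⟨e, he, hk⟩ := exists_leavesLayer_of_shortcutEdge_notMem hκ p.reverse hvb k.2
        (by simpa using h')
      exact ⟨⟨e, by simpa using he⟩, by simpa [slow, h] using hk⟩
    · obtain ⟨e, he, hk⟩ := exists_leavesLayer_of_shortcutEdge_notMem hκ p hva k.2 h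
      exact ⟨⟨e, he⟩, by simpa [slow, h] using hk⟩
  have hfast : ∀ i : Fin r, ∃ e : {e // e ∈ p.edges},
      LeavesLayer (fast i) (layerIndex r i) e.1 := by
    intro i
    by_cases h : shortcutEdge r hκ a i ∈ p.edges
    · obtain ⟨e, he, hk⟩ := exists_leavesLayer_layerIndex hκ p hva i.2
      exact ⟨⟨e, he⟩, by simpa [fast, h] using hk⟩
    · obtain ⟨e, he, hk⟩ := exists_leavesLayer_layerIndex hκ p.reverse hvb i.2
      exact ⟨⟨e, by simpa using he⟩, by simpa [fast, h] using hk⟩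
  choose f hf using hslow
  choose g hg using hfast
  have hfg : Function.Injective (Sum.elim f g) := by
    refine Function.Injective.sumElim ?_ ?_ ?_
    · intro k l h
      exact Fin.ext ((hf k).unique (h ▸ hf l)).2
    · intro i j h
      have := congrArg (levelOf r) ((hg i).unique (h ▸ hg j)).2
      rw [levelOf_layerIndex i.2.le, levelOf_layerIndex j.2.le] at this
      exact Fin.ext this
    -- A common edge would have `k = s(i)` and lie in both `slow i` and `fast i`, which are
    -- different copies.
    · intro k i h
      obtain ⟨h₁, h₂⟩ := (hf k).unique (h ▸ hg i)
      rw [h₂, levelOf_layerIndex i.2.le] at h₁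
      by_cases hs : shortcutEdge r hκ a i ∈ p.edges
      · exact hab (by simpa [slow, fast, hs] using h₁.symm)
      · exact hab (by simpa [slow, fast, hs] using h₁)
  have hcard := Fintype.card_le_of_injective _ (hc.comp hfg)
  rw [Fintype.card_sum, Fintype.card_fin, Fintype.card_fin, Fintype.card_fin, lastLayer] at hcard
  linarith

theorem le_of_isRainbowColouring (hκ : 1 ≤ κ) {n : ℕ}
    {c : (tightGraph r κ).EdgeLabeling (Fin n)} (hc : c.IsRainbowColouring) :
    r * (r + 2) ≤ n := by
  by_contra! hn
  let φ : Fin (numCopies r) → Fin r → Fin n := fun j i =>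
    c ⟨shortcutEdge r hκ j i, shortcutEdge_mem_edgeSet hκ j i.2⟩
  -- There are only `n ^ r` colour patterns of the shortcuts, fewer than the `m ^ r + 1` copies.
  obtain ⟨a, b, hab, hφ⟩ : ∃ a b, a ≠ b ∧ φ a = φ b := by
    refine Fintype.exists_ne_map_eq_of_card_lt φ ?_
    rw [Fintype.card_pi_const, Fintype.card_fin, Fintype.card_fin]
    exact Nat.lt_succ_of_le (Nat.pow_le_pow_left hn.le r)
  obtain ⟨p, -, hp⟩ := hc (tightCopy a (spine r hκ (lastLayer r)))
    (tightCopy b (spine r hκ (lastLayer r)))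
  refine hn.not_ge (le_card_of_injOn_edges hκ hab p (fun i hi ha hb => hab ?_)
    (fun e => c ⟨e.1, p.edges_subset_edgeSet e.2⟩)
    fun e e' h => Subtype.ext (hp e.1 e'.1 e.2 e'.2 h))
  -- On a rainbow path the equally coloured `i`-th shortcuts would be one edge, which forces `a =
  -- b`.
  have he := hp _ _ ha hb (congrFun hφ ⟨i, hi⟩)
  exact ((shortcutEdge_leavesLayer hκ a hi).unique (he ▸ shortcutEdge_leavesLayer hκ b hi)).1

theorem tightGraph_rainbowConnectionNumber (hκ : 1 ≤ κ) (hr : 1 ≤ r) :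
    (tightGraph r κ).rainbowConnectionNumber = r * (r + 2) := by
  refine le_antisymm (Nat.sInf_le (tightGraph_exists_isRainbowColouring hκ hr)) ?_
  -- The infimum of the empty set is 0, so the lower bound also needs a rainbow colouring to exist.
  refine le_csInf ⟨_, tightGraph_exists_isRainbowColouring hκ hr⟩ ?_
  rintro n ⟨c, hc⟩
  exact le_of_isRainbowColouring hκ hc

end Colours

theorem mainTheorem4 (κ r : ℕ) (hκ : 1 ≤ κ) (hr : 1 ≤ r) :
    (Finite (TightVertex r κ) ∧
      (tightGraph r κ).IsVertexConnected κ ∧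
      (tightGraph r κ).IsBridgeless ∧
      (tightGraph r κ).radius = r ∧
      (tightGraph r κ).center = {tightRoot r κ hκ} ∧
      (tightGraph r κ).rainbowConnectionNumber = r * (r + 2)) ∧
    (∀ B : ℕ,
      (∀ (V : Type) [Finite V] (G : SimpleGraph V),
        G.IsVertexConnected κ → G.IsBridgeless → G.radius = r →
          G.rainbowConnectionNumber ≤ B) →
      r * (r + 2) ≤ B) := by
  refine ⟨⟨inferInstance, tightGraph_isVertexConnected hκ hr, tightGraph_isBridgeless hκ,
    tightGraph_radius hκ hr, tightGraph_center hκ hr,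
    tightGraph_rainbowConnectionNumber hκ hr⟩, fun B hB => ?_⟩
  rw [← tightGraph_rainbowConnectionNumber hκ hr]
  exact hB _ _ (tightGraph_isVertexConnected hκ hr) (tightGraph_isBridgeless hκ)
    (tightGraph_radius hκ hr)
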